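/- **Setting.** Let $I\subseteq\mathbb R$ be an interval, $F$ a distribution function on $I$ (so $\int_I dF=1$) and $a:I\to\mathbb R$ a measurable function. Put $\xi:=\inf_{x\in I}a(x)$ and assume that $\xi>-\infty$, that $\xi$ is also the essential infimum of $a$ (i.e. $\int_{a<\xi+\varepsilon}dF>0$ for every $\varepsilon>0$), and that $a$ is not a.e. constant (i.e. $\int_{a<\xi+\delta}dF<1$ for some $\delta>0$). Let $$E:=\int_I a\,dF\in(-\infty,+\infty],\qquad H:=\int_I\frac{dF}{a}\ \ (\text{used if }\xi\ge 0),\qquad H_\xi:=\int_I\frac{dF}{a-\xi},$$ where $H_\xi=+\infty$ if $\int_{a=\xi}dF>0$ (so also $H=+\infty$ if $\xi=0$ and $\int_{a=0}dF>0$), and $1/\infty:=0$. Assume $E>0$. For $\max(0,\xi+1/H_\xi)<u<E$, let $\widetilde t_u$ be the solution $t\in(0,u/(u-\xi))$ of $$w_u(t):=\int_I\frac{a(x)-u}{a(x)t-ut+u}\,dF(x)=0 .$$ For $0<u<E$ define $\overline t_u$ as follows. If $\xi\ge 0$: $\overline t_u:=1$ for $0<u\le 1/H$ and $\overline t_u:=\widetilde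 t_u$ for $1/H<u<E$. If $\xi<0$: $\overline t_u:=u/(u-\xi)$ for $0<u\le\max(0,\xi+1/H_\xi)$ and $\overline t_u:=\widetilde t_u$ for $\max(0,\xi+1/H_\xi)<u<E$. Finally let $$\widetilde G_u(t):=\exp\Big(\int_I\log\big(a(x)t/u-t+1\big)\,dF(x)\Big).$$ **Theorem 4.1.** Assume $\int_{a(x)>1}\log a(x)\,dF(x)<\infty$. Then: 1. $\widetilde t_u$ exists and is unique for every $u$ with $\max(0,\xi+1/H_\xi)<u<E$, and for every $u\in(0,E)$ the integral defining $\widetilde G_u(\overline t_u)$ converges absolutely. 2. $u\mapsto\widetilde G_u(\overline t_u)$ is continuous and strictly decreasing on $(0,E)$. 3. If $\xi\ge 0$, its range on $(0,E)$ is $(1,+\infty)$. 4. If $\xi<0$, the limit $\eta:=\lim_{u\to0^+}\overline t_u/u$ exists and satisfies $0<\eta<\infty$, the function $\log(a\eta+1)$ is $dF$-integrable, and the range on $(0,E)$ is $\big(1,\ \exp\int_I\log(a(x)\eta+1)\,dF(x)\big)$. -/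

import Mathlib

open MeasureTheory Set Filter Topology

noncomputable section

namespace GrowthRate

/-- The law `dF` of a game: the Lebesgue-Stieltjes measure of `F` on the interval `I`, so that
`∫ x, g x ∂(law F I)` is `∫_I g(x) d(F(x))`. -/
def law (F : StieltjesFunction ℝ) (I : Set ℝ) : Measure ℝ := F.measure.restrict I

/-- The expectation `E = ∫_I a dF` as an extended real: integral of the positive part minus
integral of the negative part. It may be `+∞`; the negative part is integrable when `a` is
bounded below. -/
def expectation (μ : Measure ℝ) (a : ℝ → ℝ) : EReal :=
  ((∫⁻ x, ENNReal.ofReal (a x) ∂μ : ENNReal) : EReal) -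
    ((∫⁻ x, ENNReal.ofReal (-a x) ∂μ : ENNReal) : EReal)

/-- `H_c = ∫_I 1/(a - c) dF` in `[0, +∞]`, for `c ≤ a`. As `0⁻¹ = ∞` in `ENNReal`, it is `+∞`
when `a = c` on a set of positive measure. The case `c = 0` is `H = ∫_I 1/a dF`. -/
def harmonic (μ : Measure ℝ) (a : ℝ → ℝ) (c : ℝ) : ENNReal :=
  ∫⁻ x, (ENNReal.ofReal (a x - c))⁻¹ ∂μ

/-- The real number `1/H_c`, which is `0` when `H_c = +∞`. (On a nonzero measure `H_c > 0`.) -/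
def invHarmonic (μ : Measure ℝ) (a : ℝ → ℝ) (c : ℝ) : ℝ := ((harmonic μ a c)⁻¹).toReal

/-- `w_u(t) = ∫_I (a - u) / (a t - u t + u) dF`. For `max 0 ξ < u` and `0 < t < u / (u - ξ)` the
denominator is positive and the integrand is bounded. -/
def w (μ : Measure ℝ) (a : ℝ → ℝ) (u t : ℝ) : ℝ :=
  ∫ x, (a x - u) / (a x * t - u * t + u) ∂μ

/-- `t` is a solution of `w_u(t) = 0` in `(0, u / (u - ξ))`. -/
def IsPreOptimal (μ : Measure ℝ) (a : ℝ → ℝ) (ξ u t : ℝ) : Prop :=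
  t ∈ Ioo 0 (u / (u - ξ)) ∧ w μ a u t = 0

/-- The pre-optimal proportion: the solution of `w_u(t) = 0` in `(0, u / (u - ξ))`
(an unspecified number for those `u` for which there is none). -/
def preOptimal (μ : Measure ℝ) (a : ℝ → ℝ) (ξ u : ℝ) : ℝ :=
  Classical.epsilon (IsPreOptimal μ a ξ u)

open scoped Classical in
/-- The proportion `t̄_u`, for `u ≥ 0`, by cases on the sign of `ξ`. -/
def tbar (μ : Measure ℝ) (a : ℝ → ℝ) (ξ u : ℝ) : ℝ :=
  if 0 < ξ then
    if u ≤ invHarmonic μ a 0 then 1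
    else if (u : EReal) < expectation μ a then preOptimal μ a ξ u
    else 0
  else if ξ = 0 then
    if u = 0 then μ.real {x | 0 < a x}
    else if u ≤ invHarmonic μ a 0 then 1
    else if (u : EReal) < expectation μ a then preOptimal μ a ξ u
    else 0
  else
    if u ≤ max 0 (ξ + invHarmonic μ a ξ) then u / (u - ξ)
    else if (u : EReal) < expectation μ a then preOptimal μ a ξ u
    else 0

/-- The pre-growth rate `exp (∫_I log (a t / u - t + 1) dF)`. At the end point `t = u / (u - ξ)`
the integrand is `log ((a - ξ) / (u - ξ))`. -/
def growth (μ : Measure ℝ) (a : ℝ → ℝ) (u t : ℝ) : ℝ :=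
  Real.exp (∫ x, Real.log (a x * t / u - t + 1) ∂μ)

/-- The open interval `(0, E)` of prices, where `E` may be `+∞`. -/
def prices (μ : Measure ℝ) (a : ℝ → ℝ) : Set ℝ :=
  {u | 0 < u ∧ (u : EReal) < expectation μ a}

end GrowthRate

end

/-!
The growth rate at price `u` is the value of a concave maximization problem. Shifting the game by
`c = min ξ 0` to `b = a - c ≥ 0` and the price to `p = u - c`, a proportion `t` becomes a share
`r = t * (u - c) / u ∈ [0, 1]` of the capital, and the integrand of the growth rate becomes
`log (1 + r * (b / p - 1))`. The case distinction in `t̄_u` says that this share satisfies the first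
order conditions for a maximum over `(0, 1]` (`isOptimal_tbar`): up to the harmonic mean of `b` the
mean slope at `r = 1` is nonnegative, above it the mean slope vanishes at an interior point. That
point exists by Fatou's lemma at both ends of `(0, 1)` and the intermediate value theorem
(`exists_meanSlope_eq_zero`), and it is unique because the slope decreases strictly where `b ≠ p`.

By concavity the first order conditions imply that the share is a maximizer
(`IsOptimal.integral_log_le`), and the properties of the optimal rate `K p` on `0 < p < ∫ b` follow
by comparing admissible strategies instead of differentiating an implicit function.
* `K` decreases strictly: the number of units that is optimal at the higher price gains more at the
  lower one (`integral_log_lt`).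
* `K` is continuous: for `p ≤ q`, keeping at the price `q` the share that is optimal at `p` shows
  that `0 ≤ K p - K q ≤ log (q / p)` (`integral_log_sub_le`).
* The range of `K` is `(0, ∞)`: betting half of the capital makes `K` unbounded at `0`, and `K` is at
  most `∫ log (1 + b / p)`, and at most `(∫ b) / p - 1` when `b` is integrable
  (`image_optimalRate`).

For `ξ ≥ 0` there is no shift, and the range of the growth rate is `exp '' (0, ∞)`. For `ξ < 0` the
prices `u > 0` are the shifted prices `p > -ξ`, where `-ξ` is an interior point of the domain of `K`.
The optimal share is continuous there, as the sign of the mean slope at a fixed share is stable under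
a small change of the price (`continuousAt_optimalShare`); this gives `η`, and
`exp (K (-ξ))` is the supremum of the growth rate.
-/

namespace GrowthRate

/-! ### The return on one unit of capital -/

/-- The capital after one round, out of one unit, when a share `r` of it is bet at price `p` on a
game that pays `x`. -/
noncomputable def gain (p r x : ℝ) : ℝ := 1 + r * (x / p - 1)

/-- The derivative of `log (gain p r x)` with respect to the share `r`. -/
noncomputable def slope (p r x : ℝ) : ℝ := (x / p - 1) / gain p r x

lemma neg_one_le_div_sub_one {p x : ℝ} (hp : 0 < p) (hx : 0 ≤ x) : -1 ≤ x / p - 1 := by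
  have := div_nonneg hx hp.le
  linarith

lemma one_sub_le_gain {p r x : ℝ} (hp : 0 < p) (hx : 0 ≤ x) (hr : 0 ≤ r) :
    1 - r ≤ gain p r x := by
  have := neg_one_le_div_sub_one hp hx
  unfold gain
  nlinarith

lemma gain_pos {p r x : ℝ} (hp : 0 < p) (hx : 0 ≤ x) (hr : 0 ≤ r) (hr1 : r < 1) :
    0 < gain p r x :=
  (sub_pos.2 hr1).trans_le (one_sub_le_gain hp hx hr)

lemma gain_le {p r x : ℝ} (hp : 0 < p) (hx : 0 ≤ x) (hr : 0 ≤ r) (hr1 : r ≤ 1) :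
    gain p r x ≤ 1 + x / p := by
  have := div_nonneg hx hp.le
  unfold gain
  nlinarith

lemma one_sub_inv_gain {p r x : ℝ} (h : 0 < gain p r x) :
    1 - (gain p r x)⁻¹ = r * slope p r x := by
  have h' := h.ne'
  unfold slope
  field_simp
  unfold gain
  ring

lemma mul_slope_le_log_gain {p r x : ℝ} (h : 0 < gain p r x) :
    r * slope p r x ≤ Real.log (gain p r x) :=
  one_sub_inv_gain h ▸ Real.one_sub_inv_le_log_of_pos h

lemma log_gain_le {p r r' x : ℝ} (h : 0 < gain p r x) (h' : 0 < gain p r' x) :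
    Real.log (gain p r x) ≤ Real.log (gain p r' x) + (r - r') * slope p r' x := by
  have h1 := Real.log_le_sub_one_of_pos (div_pos h h')
  rw [Real.log_div h.ne' h'.ne'] at h1
  have h2 : gain p r x / gain p r' x - 1 = (r - r') * slope p r' x := by
    have := h'.ne'
    unfold slope
    field_simp
    unfold gain
    ring
  linarith

lemma slope_lt {p r r' x : ℝ} (hr : r < r') (h : 0 < gain p r x) (h' : 0 < gain p r' x)
    (hx : x / p - 1 ≠ 0) : slope p r' x < slope p r x := by
  unfold slope
  rw [div_lt_div_iff₀ h' h]
  unfold gain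
  have := mul_pos (sub_pos.2 hr) (sq_pos_of_ne_zero hx)
  nlinarith

lemma slope_le {p r r' x : ℝ} (hr : r ≤ r') (h : 0 < gain p r x) (h' : 0 < gain p r' x) :
    slope p r' x ≤ slope p r x := by
  unfold slope
  rw [div_le_div_iff₀ h' h]
  unfold gain
  have := mul_nonneg (sub_nonneg.2 hr) (sq_nonneg (x / p - 1))
  nlinarith

lemma neg_inv_le_slope {p r x : ℝ} (hp : 0 < p) (hx : 0 ≤ x) (hr : 0 ≤ r) (hr1 : r < 1) :
    -(1 - r)⁻¹ ≤ slope p r x := by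
  have hg := gain_pos hp hx hr hr1
  have h1 := neg_one_le_div_sub_one hp hx
  have h2 : 0 < 1 - r := sub_pos.2 hr1
  unfold slope
  rw [le_div_iff₀ hg, neg_mul, neg_le, ← div_eq_inv_mul, le_div_iff₀ h2]
  unfold gain
  nlinarith

lemma slope_le_inv {p r x : ℝ} (hp : 0 < p) (hx : 0 ≤ x) (hr : 0 < r) (hr1 : r < 1) :
    slope p r x ≤ r⁻¹ := by
  have hg := gain_pos hp hx hr.le hr1
  unfold slope
  rw [div_le_iff₀ hg, ← div_eq_inv_mul, le_div_iff₀ hr]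
  unfold gain
  nlinarith

lemma abs_slope_le {p r x : ℝ} (hp : 0 < p) (hx : 0 ≤ x) (hr : 0 < r) (hr1 : r < 1) :
    |slope p r x| ≤ r⁻¹ + (1 - r)⁻¹ := by
  have h1 := neg_inv_le_slope hp hx hr.le hr1
  have h2 := slope_le_inv hp hx hr hr1
  have h3 : 0 < r⁻¹ := inv_pos.2 hr
  have h4 : 0 < (1 - r)⁻¹ := inv_pos.2 (sub_pos.2 hr1)
  rw [abs_le]
  constructor <;> linarith

lemma gain_le_gain {p q r x : ℝ} (hp : 0 < p) (hpq : p ≤ q) (hr : 0 ≤ r) (hx : 0 ≤ x) :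
    gain q r x ≤ gain p r x := by
  unfold gain
  gcongr

lemma div_mul_gain_le {p q r x : ℝ} (hp : 0 < p) (hpq : p ≤ q) (hr : r ≤ 1) :
    p / q * gain p r x ≤ gain q r x := by
  have hq : 0 < q := hp.trans_le hpq
  have h1 : p / q ≤ 1 := (div_le_one hq).2 hpq
  have h2 : p / q * gain p r x = p / q * (1 - r) + r * (x / q) := by
    unfold gain
    field_simp
    ring
  rw [h2]
  unfold gain
  nlinarith

/-- When the same number of units of the game is bought at two prices, the cheaper purchase gives
more, whatever the game pays. -/
lemma gain_lt_gain {p q r x : ℝ} (hp : 0 < p) (hpq : p < q) (hr : 0 < r) :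
    gain q r x < gain p (r * p / q) x := by
  have hq : 0 < q := hp.trans hpq
  have : gain p (r * p / q) x = gain q r x + r * (1 - p / q) := by
    unfold gain
    field_simp
    ring
  have h1 : p / q < 1 := (div_lt_one hq).2 hpq
  rw [this]
  nlinarith

section Shares

/-! ### Profit functions and optimal shares -/

variable {Ω : Type*} [MeasurableSpace Ω] {μ : Measure Ω} {b : Ω → ℝ} {p q r r' : ℝ}

/-- A nonnegative profit function that is not almost everywhere constant and whose logarithmic
moment is finite. -/
structure IsProfit (μ : Measure Ω) (b : Ω → ℝ) : Prop where
  aemeasurable : AEMeasurable b μ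
  nonneg : ∀ᵐ x ∂μ, 0 ≤ b x
  not_ae_const : ∀ c : ℝ, ¬ ∀ᵐ x ∂μ, b x = c
  integrable_log : Integrable (fun x => Real.log (1 + b x)) μ

/-- The derivative of the expected logarithmic gain with respect to the share `r`. -/
noncomputable def meanSlope (μ : Measure Ω) (b : Ω → ℝ) (p r : ℝ) : ℝ := ∫ x, slope p r (b x) ∂μ

/-- The first order conditions for a maximum of the expected logarithmic gain over the shares
`0 < r ≤ 1`: the mean slope vanishes at an interior maximum, and is nonnegative at `r = 1`. -/
structure IsOptimal (μ : Measure Ω) (b : Ω → ℝ) (p r : ℝ) : Prop where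
  pos : 0 < r
  le_one : r ≤ 1
  gain_pos : ∀ᵐ x ∂μ, 0 < gain p r (b x)
  integrable_slope : Integrable (fun x => slope p r (b x)) μ
  meanSlope_nonneg : 0 ≤ meanSlope μ b p r
  meanSlope_eq : r < 1 → meanSlope μ b p r = 0

lemma measurable_gain (p r : ℝ) : Measurable (gain p r) := by
  unfold gain
  fun_prop

lemma measurable_slope (p r : ℝ) : Measurable (slope p r) := by
  unfold slope
  exact ((measurable_id.div_const p).sub_const 1).div (measurable_gain p r)

lemma integral_lt_integral_of_not_ae_eq {f g : Ω → ℝ} (hf : Integrable f μ) (hg : Integrable g μ)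
    (hle : f ≤ᵐ[μ] g) (hne : ¬ f =ᵐ[μ] g) : ∫ x, f x ∂μ < ∫ x, g x ∂μ :=
  (integral_mono_ae hf hg hle).lt_of_ne fun h => hne ((integral_eq_iff_of_ae_le hf hg hle).1 h)

namespace IsProfit

lemma ae_gain_pos (hb : IsProfit μ b) (hp : 0 < p) (hr : 0 ≤ r) (hr1 : r < 1) :
    ∀ᵐ x ∂μ, 0 < gain p r (b x) := by
  filter_upwards [hb.nonneg] with x hx using GrowthRate.gain_pos hp hx hr hr1

lemma aestronglyMeasurable_log_gain (hb : IsProfit μ b) (p r : ℝ) :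
    AEStronglyMeasurable (fun x => Real.log (gain p r (b x))) μ :=
  (Real.measurable_log.comp_aemeasurable
    ((measurable_gain p r).comp_aemeasurable hb.aemeasurable)).aestronglyMeasurable

lemma aestronglyMeasurable_slope (hb : IsProfit μ b) (p r : ℝ) :
    AEStronglyMeasurable (fun x => slope p r (b x)) μ :=
  ((measurable_slope p r).comp_aemeasurable hb.aemeasurable).aestronglyMeasurable

variable [IsProbabilityMeasure μ]

lemma integrable_slope (hb : IsProfit μ b) (hp : 0 < p) (hr : 0 < r) (hr1 : r < 1) :
    Integrable (fun x => slope p r (b x)) μ := by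
  refine (integrable_const (r⁻¹ + (1 - r)⁻¹)).mono' (hb.aestronglyMeasurable_slope p r) ?_
  filter_upwards [hb.nonneg] with x hx using abs_slope_le hp hx hr hr1

lemma integrable_log_one_add_div (hb : IsProfit μ b) (hp : 0 < p) :
    Integrable (fun x => Real.log (1 + b x / p)) μ := by
  refine integrable_of_le_of_le (g₁ := 0)
    (g₂ := fun x => Real.log (1 + 1 / p) + Real.log (1 + b x)) ?_ ?_ ?_
    (integrable_zero _ _ _) ((integrable_const _).add hb.integrable_log)
  · exact (Real.measurable_log.comp_aemeasurable
      ((hb.aemeasurable.div_const p).const_add 1)).aestronglyMeasurable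
  · filter_upwards [hb.nonneg] with x hx
    have := div_nonneg hx hp.le
    exact Real.log_nonneg (by linarith)
  · filter_upwards [hb.nonneg] with x hx
    have h1 := div_nonneg hx hp.le
    have h2 : 0 < 1 / p := by positivity
    rw [← Real.log_mul (by positivity) (by positivity)]
    apply Real.log_le_log (by positivity)
    have h3 : b x / p = 1 / p * b x := by ring
    nlinarith

lemma integrable_log_gain (hb : IsProfit μ b) (hp : 0 < p) (hr : 0 ≤ r) (hr1 : r < 1) :
    Integrable (fun x => Real.log (gain p r (b x))) μ := by
  refine integrable_of_le_of_le (hb.aestronglyMeasurable_log_gain p r) ?_ ?_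
    (integrable_const (Real.log (1 - r))) (hb.integrable_log_one_add_div hp)
  · filter_upwards [hb.nonneg] with x hx
    exact Real.log_le_log (sub_pos.2 hr1) (one_sub_le_gain hp hx hr)
  · filter_upwards [hb.nonneg] with x hx
    exact Real.log_le_log (GrowthRate.gain_pos hp hx hr hr1) (gain_le hp hx hr hr1.le)

lemma meanSlope_lt (hb : IsProfit μ b) (hp : 0 < p) (hr : 0 < r) (hrr : r < r')
    (hg : ∀ᵐ x ∂μ, 0 < gain p r' (b x)) (hi : Integrable (fun x => slope p r' (b x)) μ)
    (hr1 : r' ≤ 1) : meanSlope μ b p r' < meanSlope μ b p r := by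
  have hr0 := hb.ae_gain_pos hp hr.le (hrr.trans_le hr1)
  refine integral_lt_integral_of_not_ae_eq hi (hb.integrable_slope hp hr (hrr.trans_le hr1)) ?_ ?_
  · filter_upwards [hr0, hg] with x h h' using slope_le hrr.le h h'
  · intro h
    refine hb.not_ae_const p ?_
    filter_upwards [hr0, hg, h] with x h1 h2 h3
    by_contra hne
    refine (slope_lt hrr h1 h2 ?_).ne h3
    rwa [sub_ne_zero, Ne, div_eq_one_iff_eq hp.ne']

lemma meanSlope_lt_of_lt_one (hb : IsProfit μ b) (hp : 0 < p) (hr : 0 < r) (hrr : r < r')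
    (hr1 : r' < 1) : meanSlope μ b p r' < meanSlope μ b p r :=
  hb.meanSlope_lt hp hr hrr (hb.ae_gain_pos hp (hr.trans hrr).le hr1)
    (hb.integrable_slope hp (hr.trans hrr) hr1) hr1.le

lemma continuousAt_meanSlope (hb : IsProfit μ b) (hp : 0 < p) (hr : 0 < r) (hr1 : r < 1) :
    ContinuousAt (fun z : ℝ × ℝ => meanSlope μ b z.1 z.2) (p, r) := by
  have h1 : ∀ᶠ z : ℝ × ℝ in 𝓝 (p, r), 0 < z.1 :=
    continuous_fst.continuousAt.eventually (lt_mem_nhds hp)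
  have h2 : ∀ᶠ z : ℝ × ℝ in 𝓝 (p, r), r / 2 < z.2 :=
    continuous_snd.continuousAt.eventually (lt_mem_nhds (half_lt_self hr))
  have h3 : ∀ᶠ z : ℝ × ℝ in 𝓝 (p, r), z.2 < (1 + r) / 2 :=
    continuous_snd.continuousAt.eventually (gt_mem_nhds (by simp only; linarith))
  refine continuousAt_of_dominated (bound := fun _ => (r / 2)⁻¹ + (1 - (1 + r) / 2)⁻¹)
    (Eventually.of_forall fun z => hb.aestronglyMeasurable_slope _ _) ?_ (integrable_const _) ?_
  · filter_upwards [h1, h2, h3] with z hz1 hz2 hz3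
    filter_upwards [hb.nonneg] with x hx
    refine (abs_slope_le hz1 hx (by linarith) (by linarith)).trans ?_
    have : 0 < 1 - (1 + r) / 2 := by linarith
    gcongr
  · filter_upwards [hb.nonneg] with x hx
    have hg := (GrowthRate.gain_pos hp hx hr.le hr1).ne'
    have hp' := hp.ne'
    unfold slope gain at *
    fun_prop (disch := assumption)

end IsProfit

namespace IsOptimal

variable [IsProbabilityMeasure μ]

lemma integrable_log (h : IsOptimal μ b p r) (hb : IsProfit μ b) (hp : 0 < p) :
    Integrable (fun x => Real.log (gain p r (b x))) μ := by
  refine integrable_of_le_of_le (hb.aestronglyMeasurable_log_gain p r) ?_ ?_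
    (h.integrable_slope.const_mul r) (hb.integrable_log_one_add_div hp)
  · filter_upwards [h.gain_pos] with x hx using mul_slope_le_log_gain hx
  · filter_upwards [h.gain_pos, hb.nonneg] with x hx hx'
    exact Real.log_le_log hx (gain_le hp hx' h.pos.le h.le_one)

/-- The first order conditions are sufficient for a maximum, by concavity of the logarithm. -/
lemma integral_log_le (h : IsOptimal μ b p r) (hb : IsProfit μ b) (hp : 0 < p) (hr1 : r' ≤ 1)
    (hg : ∀ᵐ x ∂μ, 0 < gain p r' (b x))
    (hi : Integrable (fun x => Real.log (gain p r' (b x))) μ) :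
    ∫ x, Real.log (gain p r' (b x)) ∂μ ≤ ∫ x, Real.log (gain p r (b x)) ∂μ := by
  have h1 : ∫ x, Real.log (gain p r' (b x)) ∂μ ≤
      ∫ x, (Real.log (gain p r (b x)) + (r' - r) * slope p r (b x)) ∂μ := by
    refine integral_mono_ae hi
      ((h.integrable_log hb hp).add (h.integrable_slope.const_mul _)) ?_
    filter_upwards [h.gain_pos, hg] with x hx hx' using log_gain_le hx' hx
  rw [integral_add (h.integrable_log hb hp) (h.integrable_slope.const_mul _),
    integral_const_mul] at h1
  have h2 : (r' - r) * meanSlope μ b p r ≤ 0 := by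
    rcases h.le_one.lt_or_eq with hr | rfl
    · rw [h.meanSlope_eq hr, mul_zero]
    · exact mul_nonpos_of_nonpos_of_nonneg (by linarith) h.meanSlope_nonneg
  unfold meanSlope at h2
  linarith

lemma eq (h : IsOptimal μ b p r) (h' : IsOptimal μ b p r') (hb : IsProfit μ b) (hp : 0 < p) :
    r = r' := by
  have key : ∀ {s s'}, IsOptimal μ b p s → IsOptimal μ b p s' → ¬ s < s' := fun h h' hs => by
    have := hb.meanSlope_lt hp h.pos hs h'.gain_pos h'.integrable_slope h'.le_one
    have h1 := h.meanSlope_eq (hs.trans_le h'.le_one)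
    have h2 := h'.meanSlope_nonneg
    linarith
  exact le_antisymm (not_lt.1 (key h' h)) (not_lt.1 (key h h'))

lemma lt_of_meanSlope_pos (h : IsOptimal μ b p r) (hb : IsProfit μ b) (hp : 0 < p)
    (hr1 : r' < 1) (hpos : 0 < meanSlope μ b p r') : r' < r := by
  by_contra! hle
  have h0 := h.meanSlope_eq (hle.trans_lt hr1)
  rcases hle.lt_or_eq with hlt | rfl
  · linarith [hb.meanSlope_lt_of_lt_one hp h.pos hlt hr1]
  · linarith

lemma lt_of_meanSlope_neg (h : IsOptimal μ b p r) (hb : IsProfit μ b) (hp : 0 < p)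
    (hr0 : 0 < r') (hneg : meanSlope μ b p r' < 0) : r < r' := by
  by_contra! hle
  have h0 := h.meanSlope_nonneg
  rcases hle.lt_or_eq with hlt | rfl
  · linarith [hb.meanSlope_lt hp hr0 hlt h.gain_pos h.integrable_slope h.le_one]
  · linarith

/-- The optimal growth rate decreases strictly in the price: at the lower price, buying the number
of units that is optimal at the higher price is admissible and gains more. -/
lemma integral_log_lt (h : IsOptimal μ b p r) (h' : IsOptimal μ b q r') (hb : IsProfit μ b)
    (hp : 0 < p) (hpq : p < q) :
    ∫ x, Real.log (gain q r' (b x)) ∂μ < ∫ x, Real.log (gain p r (b x)) ∂μ := by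
  have hq : 0 < q := hp.trans hpq
  have hs0 : 0 < r' * p / q := div_pos (mul_pos h'.pos hp) hq
  have hs1 : r' * p / q < 1 := by
    rw [div_lt_one hq]
    nlinarith [h'.le_one]
  have hi := hb.integrable_log_gain hp hs0.le hs1
  have hlt : ∀ᵐ x ∂μ,
      Real.log (gain q r' (b x)) < Real.log (gain p (r' * p / q) (b x)) := by
    filter_upwards [h'.gain_pos] with x hx
    exact Real.log_lt_log hx (gain_lt_gain hp hpq h'.pos)
  refine (integral_lt_integral_of_not_ae_eq (h'.integrable_log hb hq) hi ?_ ?_).trans_le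
    (h.integral_log_le hb hp hs1.le (hb.ae_gain_pos hp hs0.le hs1) hi)
  · filter_upwards [hlt] with x hx using hx.le
  · intro heq
    obtain ⟨x, hx, hx'⟩ := (hlt.and heq).exists
    exact hx.ne hx'

/-- Keeping the share that is optimal at the price `p` after a rise of the price to `q` costs at
most a factor `q / p`. -/
lemma integral_log_sub_le (h : IsOptimal μ b p r) (h' : IsOptimal μ b q r') (hb : IsProfit μ b)
    (hp : 0 < p) (hpq : p ≤ q) :
    ∫ x, Real.log (gain p r (b x)) ∂μ - ∫ x, Real.log (gain q r' (b x)) ∂μ ≤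
      Real.log q - Real.log p := by
  have hq : 0 < q := hp.trans_le hpq
  have hg : ∀ᵐ x ∂μ, 0 < gain q r (b x) := by
    filter_upwards [h.gain_pos] with x hx
    exact (mul_pos (div_pos hp hq) hx).trans_le (div_mul_gain_le hp hpq h.le_one)
  have hlow : ∀ᵐ x ∂μ, (Real.log p - Real.log q) + Real.log (gain p r (b x)) ≤
      Real.log (gain q r (b x)) := by
    filter_upwards [h.gain_pos] with x hx
    rw [← Real.log_div hp.ne' hq.ne', ← Real.log_mul (div_pos hp hq).ne' hx.ne']
    exact Real.log_le_log (mul_pos (div_pos hp hq) hx) (div_mul_gain_le hp hpq h.le_one)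
  have hl := h.integrable_log hb hp
  have hc : Integrable (fun _ => Real.log p - Real.log q) μ := integrable_const _
  have hi : Integrable (fun x => Real.log (gain q r (b x))) μ := by
    refine integrable_of_le_of_le (hb.aestronglyMeasurable_log_gain q r) hlow ?_ (hc.add hl) hl
    filter_upwards [hb.nonneg, hg] with x hx hx'
    exact Real.log_le_log hx' (gain_le_gain hp hpq h.pos.le hx)
  have h1 := integral_mono_ae (hc.add hl) hi hlow
  have h2 := h'.integral_log_le hb hq h.le_one hg hi
  simp only [Pi.add_apply] at h1
  rw [integral_add hc hl, integral_const, probReal_univ, one_smul] at h1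
  linarith

end IsOptimal

/-! ### Existence of the optimal share -/

/-- Fatou's lemma in the form: a strict lower bound of the integral of a pointwise limit is
eventually a strict lower bound of the integrals. -/
lemma eventually_lt_lintegral {ι : Type*} {l : Filter ι} [l.IsCountablyGenerated] [l.NeBot]
    {F : ι → Ω → ENNReal} {f : Ω → ENNReal} {c : ENNReal} (hF : ∀ i, AEMeasurable (F i) μ)
    (hlim : ∀ᵐ x ∂μ, Tendsto (fun i => F i x) l (𝓝 (f x))) (hc : c < ∫⁻ x, f x ∂μ) :
    ∀ᶠ i in l, c < ∫⁻ x, F i x ∂μ := by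
  have h : ∫⁻ x, f x ∂μ = ∫⁻ x, liminf (fun i => F i x) l ∂μ := by
    apply lintegral_congr_ae
    filter_upwards [hlim] with x hx using hx.liminf_eq.symm
  exact eventually_lt_of_lt_liminf ((hc.trans_eq h).trans_le (lintegral_liminf_le' hF))

lemma continuousAt_gain_share (p r x : ℝ) : ContinuousAt (fun s => gain p s x) r := by
  unfold gain
  fun_prop

lemma lintegral_ofReal_div (hp : 0 < p) (b : Ω → ℝ) (μ : Measure Ω) :
    ∫⁻ x, ENNReal.ofReal (b x / p) ∂μ = (∫⁻ x, ENNReal.ofReal (b x) ∂μ) / ENNReal.ofReal p := by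
  simp_rw [ENNReal.ofReal_div_of_pos hp, div_eq_mul_inv]
  exact lintegral_mul_const' _ _ (by simpa using hp)

namespace IsProfit

lemma lintegral_ne_zero (hb : IsProfit μ b) : ∫⁻ x, ENNReal.ofReal (b x) ∂μ ≠ 0 := by
  rw [Ne, lintegral_eq_zero_iff' hb.aemeasurable.ennreal_ofReal]
  intro h
  refine hb.not_ae_const 0 ?_
  filter_upwards [h, hb.nonneg] with x hx hx'
  exact le_antisymm (ENNReal.ofReal_eq_zero.1 hx) hx'

variable [IsProbabilityMeasure μ]

/-- Below the expectation, a small bet has a positive mean slope. -/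
lemma eventually_meanSlope_pos (hb : IsProfit μ b) (hp : 0 < p)
    (hE : ENNReal.ofReal p < ∫⁻ x, ENNReal.ofReal (b x) ∂μ) :
    ∀ᶠ r in 𝓝[>] 0, 0 < meanSlope μ b p r := by
  -- The slopes at `r < 1 / 2` are at least `-2`, so Fatou's lemma applies to `slope + 2`.
  have hlim : ∀ᵐ x ∂μ, Tendsto (fun r => ENNReal.ofReal (slope p r (b x) + 2)) (𝓝[>] 0)
      (𝓝 (ENNReal.ofReal (b x / p) + 1)) := by
    filter_upwards [hb.nonneg] with x hx
    have h0 : gain p 0 (b x) = 1 := by simp [gain]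
    have h1 : ContinuousAt (fun r => slope p r (b x) + 2) 0 := by
      unfold slope
      exact (continuousAt_const.div (continuousAt_gain_share _ _ _) (by simp [h0])).add
        continuousAt_const
    have h2 := (ENNReal.continuous_ofReal.continuousAt.comp h1).tendsto.mono_left
      (nhdsWithin_le_nhds (s := Ioi 0))
    have h3 : slope p 0 (b x) + 2 = b x / p + 1 := by
      unfold slope
      rw [h0]
      ring
    simp only [Function.comp_def, h3] at h2
    rwa [ENNReal.ofReal_add (div_nonneg hx hp.le) zero_le_one, ENNReal.ofReal_one] at h2
  have hc : (2 : ENNReal) < ∫⁻ x, (ENNReal.ofReal (b x / p) + 1) ∂μ := by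
    rw [lintegral_add_right _ measurable_const, lintegral_ofReal_div hp, lintegral_const,
      measure_univ, one_mul, ← one_add_one_eq_two]
    refine ENNReal.add_lt_add_right ENNReal.one_ne_top ?_
    rwa [ENNReal.lt_div_iff_mul_lt (by simp [hp]) (by simp), one_mul]
  filter_upwards [eventually_lt_lintegral (fun r =>
      ((hb.aestronglyMeasurable_slope p r).aemeasurable.add_const 2).ennreal_ofReal) hlim hc,
    self_mem_nhdsWithin, mem_nhdsWithin_of_mem_nhds (Iio_mem_nhds (by norm_num : (0 : ℝ) < 1 / 2))]
    with r h hr0 hr1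
  simp only [mem_Ioi, mem_Iio] at hr0 hr1
  have hi := hb.integrable_slope hp hr0 (by linarith)
  have hi2 : Integrable (fun x => slope p r (b x) + 2) μ := hi.add (integrable_const 2)
  rw [← ofReal_integral_eq_lintegral_ofReal hi2] at h
  · rw [integral_add hi (integrable_const 2), integral_const, probReal_univ,
      one_smul] at h
    have h2 : ENNReal.ofReal 2 = 2 := by simp
    rw [← h2, ENNReal.ofReal_lt_ofReal_iff_of_nonneg zero_le_two] at h
    unfold meanSlope
    linarith
  · filter_upwards [hb.nonneg] with x hx
    have h1 := neg_inv_le_slope hp hx hr0.le (by linarith)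
    have h2 : (1 - r)⁻¹ ≤ 2 := inv_le_of_inv_le₀ two_pos (by linarith)
    simp only [Pi.zero_apply]
    linarith

/-- Above the harmonic mean, betting almost everything has a negative mean slope. -/
lemma eventually_meanSlope_neg (hb : IsProfit μ b) (hp : 0 < p)
    (hH : 1 < ENNReal.ofReal p * ∫⁻ x, (ENNReal.ofReal (b x))⁻¹ ∂μ) :
    ∀ᶠ r in 𝓝[<] 1, meanSlope μ b p r < 0 := by
  -- Fatou's lemma applies to `1 / gain`, whose integral is `1 - r * meanSlope`.
  have hlim : ∀ᵐ x ∂μ, Tendsto (fun r => (ENNReal.ofReal (gain p r (b x)))⁻¹) (𝓝[<] 1)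
      (𝓝 (ENNReal.ofReal p * (ENNReal.ofReal (b x))⁻¹)) := by
    filter_upwards with x
    have h1 := ((ENNReal.continuous_ofReal.continuousAt.comp
      (continuousAt_gain_share p 1 (b x))).tendsto.mono_left
      (nhdsWithin_le_nhds (s := Iio 1))).inv
    have h2 : (ENNReal.ofReal (gain p 1 (b x)))⁻¹ =
        ENNReal.ofReal p * (ENNReal.ofReal (b x))⁻¹ := by
      have : gain p 1 (b x) = b x / p := by simp [gain]
      rw [this, ENNReal.ofReal_div_of_pos hp,
        ENNReal.inv_div (Or.inl (by simp)) (Or.inl (by simp [hp])), div_eq_mul_inv]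
    rw [← h2]
    exact h1
  have hc : (1 : ENNReal) < ∫⁻ x, ENNReal.ofReal p * (ENNReal.ofReal (b x))⁻¹ ∂μ := by
    rwa [lintegral_const_mul' _ _ (by simp)]
  filter_upwards [eventually_lt_lintegral (fun r =>
      ((measurable_gain p r).comp_aemeasurable hb.aemeasurable).ennreal_ofReal.inv) hlim hc,
    self_mem_nhdsWithin, mem_nhdsWithin_of_mem_nhds (Ioi_mem_nhds (zero_lt_one : (0 : ℝ) < 1))]
    with r h hr1 hr0
  simp only [mem_Ioi, mem_Iio] at hr0 hr1
  have hi := (hb.integrable_slope hp hr0 hr1).const_mul r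
  have hg := hb.ae_gain_pos hp hr0.le hr1
  have h1 : ∫⁻ x, (ENNReal.ofReal (gain p r (b x)))⁻¹ ∂μ =
      ENNReal.ofReal (1 - r * meanSlope μ b p r) := by
    have h2 : 1 - r * meanSlope μ b p r = ∫ x, (1 - r * slope p r (b x)) ∂μ := by
      rw [integral_sub (integrable_const _) hi, integral_const_mul, integral_const,
        probReal_univ, one_smul]
      rfl
    have hi1 : Integrable (fun x => 1 - r * slope p r (b x)) μ := (integrable_const 1).sub hi
    rw [h2, ofReal_integral_eq_lintegral_ofReal hi1]
    · apply lintegral_congr_ae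
      filter_upwards [hg] with x hx
      rw [← one_sub_inv_gain hx, sub_sub_cancel, ENNReal.ofReal_inv_of_pos hx]
    · filter_upwards [hg] with x hx
      rw [Pi.zero_apply, ← one_sub_inv_gain hx, sub_sub_cancel]
      exact (inv_pos.2 hx).le
  replace h := h.trans_eq h1
  rw [← ENNReal.ofReal_one, ENNReal.ofReal_lt_ofReal_iff_of_nonneg zero_le_one] at h
  by_contra! hn
  nlinarith [mul_nonneg hr0.le hn]

/-- Strictly between the harmonic and the arithmetic mean of `b`, some interior share satisfies the
first order condition. -/
lemma exists_meanSlope_eq_zero (hb : IsProfit μ b) (hp : 0 < p)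
    (hE : ENNReal.ofReal p < ∫⁻ x, ENNReal.ofReal (b x) ∂μ)
    (hH : 1 < ENNReal.ofReal p * ∫⁻ x, (ENNReal.ofReal (b x))⁻¹ ∂μ) :
    ∃ r ∈ Ioo (0 : ℝ) 1, meanSlope μ b p r = 0 := by
  obtain ⟨r₁, h₁, hr₁⟩ := ((hb.eventually_meanSlope_pos hp hE).and
    (Ioo_mem_nhdsGT zero_lt_one)).exists
  obtain ⟨r₂, h₂, hr₂⟩ := ((hb.eventually_meanSlope_neg hp hH).and
    (Ioo_mem_nhdsLT zero_lt_one)).exists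
  have hc : ContinuousOn (meanSlope μ b p) (Ioo 0 1) := fun r hr =>
    ((hb.continuousAt_meanSlope hp hr.1 hr.2).comp (f := fun r => (p, r))
      (by fun_prop)).continuousWithinAt
  exact isPreconnected_Ioo.intermediate_value hr₂ hr₁ hc ⟨h₂.le, h₁.le⟩

lemma isOptimal_of_meanSlope_eq_zero (hb : IsProfit μ b) (hp : 0 < p) (hr : r ∈ Ioo (0 : ℝ) 1)
    (h : meanSlope μ b p r = 0) : IsOptimal μ b p r :=
  ⟨hr.1, hr.2.le, hb.ae_gain_pos hp hr.1.le hr.2, hb.integrable_slope hp hr.1 hr.2, h.ge,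
    fun _ => h⟩

/-- Up to the harmonic mean, betting everything is optimal. -/
lemma isOptimal_one (hb : IsProfit μ b) (hp : 0 < p)
    (hH : ENNReal.ofReal p * ∫⁻ x, (ENNReal.ofReal (b x))⁻¹ ∂μ ≤ 1) : IsOptimal μ b p 1 := by
  have hm : AEMeasurable (fun x => (ENNReal.ofReal (b x))⁻¹) μ :=
    hb.aemeasurable.ennreal_ofReal.inv
  have hfin : ∫⁻ x, (ENNReal.ofReal (b x))⁻¹ ∂μ ≠ ⊤ := by
    intro h
    rw [h, ENNReal.mul_top (by simp [hp])] at hH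
    simp at hH
  have hae := ae_lt_top' hm hfin
  have hpos : ∀ᵐ x ∂μ, 0 < b x := by
    filter_upwards [hae] with x hx
    simpa using hx
  have hinv : ∀ᵐ x ∂μ, ((ENNReal.ofReal (b x))⁻¹).toReal = (b x)⁻¹ := by
    filter_upwards [hpos] with x hx
    rw [ENNReal.toReal_inv, ENNReal.toReal_ofReal hx.le]
  have hi : Integrable (fun x => (b x)⁻¹) μ :=
    (integrable_toReal_of_lintegral_ne_top hm hfin).congr hinv
  have hint : ∫ x, (b x)⁻¹ ∂μ = (∫⁻ x, (ENNReal.ofReal (b x))⁻¹ ∂μ).toReal := by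
    rw [← integral_toReal hm hae]
    exact (integral_congr_ae hinv).symm
  have hslope : ∀ᵐ x ∂μ, 1 - p * (b x)⁻¹ = slope p 1 (b x) := by
    filter_upwards [hpos] with x hx
    have : gain p 1 (b x) = b x / p := by simp [gain]
    unfold slope
    rw [this]
    field_simp
  have hi' : Integrable (fun x => 1 - p * (b x)⁻¹) μ := (integrable_const _).sub (hi.const_mul p)
  refine ⟨one_pos, le_rfl, ?_, hi'.congr hslope, ?_, fun h => absurd h (lt_irrefl _)⟩
  · filter_upwards [hpos] with x hx
    have : gain p 1 (b x) = b x / p := by simp [gain]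
    rw [this]
    exact div_pos hx hp
  · unfold meanSlope
    rw [← integral_congr_ae hslope, integral_sub (integrable_const _) (hi.const_mul p),
      integral_const_mul, integral_const, probReal_univ, one_smul, hint]
    have := ENNReal.toReal_mono ENNReal.one_ne_top hH
    rw [ENNReal.toReal_mul, ENNReal.toReal_ofReal hp.le, ENNReal.toReal_one] at this
    linarith

lemma exists_isOptimal (hb : IsProfit μ b) (hp : 0 < p)
    (hE : ENNReal.ofReal p < ∫⁻ x, ENNReal.ofReal (b x) ∂μ) : ∃ r, IsOptimal μ b p r := by
  rcases le_or_gt (ENNReal.ofReal p * ∫⁻ x, (ENNReal.ofReal (b x))⁻¹ ∂μ) 1 with h | h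
  · exact ⟨1, hb.isOptimal_one hp h⟩
  · obtain ⟨r, hr, h0⟩ := hb.exists_meanSlope_eq_zero hp hE h
    exact ⟨r, hb.isOptimal_of_meanSlope_eq_zero hp hr h0⟩

end IsProfit

/-! ### The optimal growth rate as a function of the price -/

/-- The optimal share at the price `p`; an unspecified number if there is none. -/
noncomputable def optimalShare (μ : Measure Ω) (b : Ω → ℝ) (p : ℝ) : ℝ :=
  Classical.epsilon (IsOptimal μ b p)

/-- The expected logarithmic gain at the optimal share. -/
noncomputable def optimalRate (μ : Measure Ω) (b : Ω → ℝ) (p : ℝ) : ℝ :=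
  ∫ x, Real.log (gain p (optimalShare μ b p) (b x)) ∂μ

/-- The open interval from `0` to the expectation of `b`, which may be infinite. -/
def favourablePrices (μ : Measure Ω) (b : Ω → ℝ) : Set ℝ :=
  {p | 0 < p ∧ ENNReal.ofReal p < ∫⁻ x, ENNReal.ofReal (b x) ∂μ}

lemma isOpen_favourablePrices : IsOpen (favourablePrices μ b) :=
  (isOpen_lt continuous_const continuous_id).inter
    (isOpen_lt ENNReal.continuous_ofReal continuous_const)

lemma mem_favourablePrices_of_le (h : q ∈ favourablePrices μ b) (hp : 0 < p) (hpq : p ≤ q) :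
    p ∈ favourablePrices μ b :=
  ⟨hp, (ENNReal.ofReal_le_ofReal hpq).trans_lt h.2⟩

lemma ordConnected_favourablePrices : (favourablePrices μ b).OrdConnected :=
  ⟨fun _ hp _ hq _ hx => mem_favourablePrices_of_le hq (hp.1.trans_le hx.1) hx.2⟩

namespace IsProfit

variable [IsProbabilityMeasure μ]

lemma isOptimal_optimalShare (hb : IsProfit μ b) (hp : p ∈ favourablePrices μ b) :
    IsOptimal μ b p (optimalShare μ b p) :=
  Classical.epsilon_spec (hb.exists_isOptimal hp.1 hp.2)

lemma optimalShare_eq (hb : IsProfit μ b) (hp : p ∈ favourablePrices μ b)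
    (h : IsOptimal μ b p r) : optimalShare μ b p = r :=
  (hb.isOptimal_optimalShare hp).eq h hb hp.1

/-- The sign of the mean slope tells on which side of a share the optimal one lies, and it persists
under a small change of the price. -/
lemma continuousAt_optimalShare (hb : IsProfit μ b) (hp : p ∈ favourablePrices μ b) :
    ContinuousAt (optimalShare μ b) p := by
  have h := hb.isOptimal_optimalShare hp
  have hS := isOpen_favourablePrices.mem_nhds hp
  have hcont : ∀ s, 0 < s → s < 1 → ContinuousAt (fun q => meanSlope μ b q s) p :=
    fun s hs hs1 => (hb.continuousAt_meanSlope hp.1 hs hs1).comp (f := fun q => (q, s))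
      (by fun_prop)
  refine tendsto_order.2 ⟨fun s hs => ?_, fun s hs => ?_⟩
  · have h1 : max s (optimalShare μ b p / 2) < optimalShare μ b p :=
      max_lt hs (half_lt_self h.pos)
    have h0 : 0 < max s (optimalShare μ b p / 2) := lt_max_of_lt_right (half_pos h.pos)
    have hlt1 := h1.trans_le h.le_one
    have hpos : 0 < meanSlope μ b p (max s (optimalShare μ b p / 2)) :=
      h.meanSlope_nonneg.trans_lt
        (hb.meanSlope_lt hp.1 h0 h1 h.gain_pos h.integrable_slope h.le_one)
    filter_upwards [hS, (hcont _ h0 hlt1).eventually (lt_mem_nhds hpos)] with q hq hq'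
    exact (le_max_left _ _).trans_lt
      ((hb.isOptimal_optimalShare hq).lt_of_meanSlope_pos hb hq.1 hlt1 hq')
  · rcases h.le_one.lt_or_eq with hlt | heq
    · have h1 : optimalShare μ b p < min s ((1 + optimalShare μ b p) / 2) :=
        lt_min hs (by linarith)
      have h0 := h.pos.trans h1
      have hlt1 : min s ((1 + optimalShare μ b p) / 2) < 1 := min_lt_of_right_lt (by linarith)
      have hneg : meanSlope μ b p (min s ((1 + optimalShare μ b p) / 2)) < 0 :=
        (hb.meanSlope_lt_of_lt_one hp.1 h.pos h1 hlt1).trans_eq (h.meanSlope_eq hlt)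
      filter_upwards [hS, (hcont _ h0 hlt1).eventually (gt_mem_nhds hneg)] with q hq hq'
      exact ((hb.isOptimal_optimalShare hq).lt_of_meanSlope_neg hb hq.1 h0 hq').trans_le
        (min_le_left _ _)
    · filter_upwards [hS] with q hq
      exact (hb.isOptimal_optimalShare hq).le_one.trans_lt (heq ▸ hs)

lemma strictAntiOn_optimalRate (hb : IsProfit μ b) :
    StrictAntiOn (optimalRate μ b) (favourablePrices μ b) := fun _ hp _ hq hpq =>
  (hb.isOptimal_optimalShare hp).integral_log_lt (hb.isOptimal_optimalShare hq) hb hp.1 hpq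

lemma abs_optimalRate_sub_le (hb : IsProfit μ b) (hp : p ∈ favourablePrices μ b)
    (hq : q ∈ favourablePrices μ b) :
    |optimalRate μ b p - optimalRate μ b q| ≤ |Real.log p - Real.log q| := by
  wlog hpq : p ≤ q generalizing p q
  · rw [abs_sub_comm, abs_sub_comm (Real.log p)]
    exact this hq hp (le_of_not_ge hpq)
  rw [abs_sub_comm (Real.log p),
    abs_of_nonneg (sub_nonneg.2 (hb.strictAntiOn_optimalRate.antitoneOn hp hq hpq))]
  exact ((hb.isOptimal_optimalShare hp).integral_log_sub_le (hb.isOptimal_optimalShare hq) hb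
    hp.1 hpq).trans (le_abs_self _)

lemma continuousOn_optimalRate (hb : IsProfit μ b) :
    ContinuousOn (optimalRate μ b) (favourablePrices μ b) := by
  intro p hp
  have hlog : Tendsto (fun q => |Real.log q - Real.log p|) (𝓝[favourablePrices μ b] p) (𝓝 0) := by
    have h := ((Real.continuousAt_log hp.1.ne').sub continuousAt_const).abs.tendsto
      (f := fun q => |Real.log q - Real.log p|)
    simpa using h.mono_left nhdsWithin_le_nhds
  refine tendsto_iff_dist_tendsto_zero.2 (squeeze_zero' (Eventually.of_forall fun _ => dist_nonneg)
    ?_ hlog)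
  filter_upwards [self_mem_nhdsWithin] with q hq using hb.abs_optimalRate_sub_le hq hp

lemma le_optimalRate (hb : IsProfit μ b) (hp : p ∈ favourablePrices μ b) (hr : 0 ≤ r)
    (hr1 : r < 1) : ∫ x, Real.log (gain p r (b x)) ∂μ ≤ optimalRate μ b p :=
  (hb.isOptimal_optimalShare hp).integral_log_le hb hp.1 hr1.le (hb.ae_gain_pos hp.1 hr hr1)
    (hb.integrable_log_gain hp.1 hr hr1)

lemma optimalRate_pos (hb : IsProfit μ b) (hp : p ∈ favourablePrices μ b) :
    0 < optimalRate μ b p := by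
  obtain ⟨q, hq, hpq⟩ := (((isOpen_favourablePrices.eventually_mem hp).filter_mono
    (nhdsWithin_le_nhds (s := Ioi p))).and self_mem_nhdsWithin).exists
  have h0 : 0 ≤ optimalRate μ b q := by
    simpa [gain] using hb.le_optimalRate hq le_rfl one_pos
  exact h0.trans_lt (hb.strictAntiOn_optimalRate hp hq hpq)

/-- The optimal growth rate is unbounded as the price tends to `0`: betting half of the capital is
enough. -/
lemma exists_lt_optimalRate (hb : IsProfit μ b) (y : ℝ) :
    ∃ p ∈ favourablePrices μ b, y < optimalRate μ b p := by
  have hlim : ∀ᵐ x ∂μ, Tendsto (fun p => ENNReal.ofReal (Real.log (1 + b x / p))) (𝓝[>] 0)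
      (𝓝 (⊤ * ENNReal.ofReal (b x))) := by
    filter_upwards [hb.nonneg] with x hx
    rcases hx.eq_or_lt with h0 | h0
    · simp [← h0]
    · rw [ENNReal.top_mul (by simpa using h0)]
      have h1 : Tendsto (fun p => b x / p) (𝓝[>] 0) atTop := by
        simp_rw [div_eq_mul_inv]
        exact tendsto_inv_nhdsGT_zero.const_mul_atTop h0
      exact ENNReal.tendsto_ofReal_atTop.comp (Real.tendsto_log_atTop.comp
        (tendsto_atTop_add_const_left _ 1 h1))
  -- The limit is `∞` on the set `b > 0`, which has positive measure, so its integral is `∞`.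
  have hc : ENNReal.ofReal (max y 0 + Real.log 2) < ∫⁻ x, ⊤ * ENNReal.ofReal (b x) ∂μ := by
    rw [lintegral_const_mul'' _ hb.aemeasurable.ennreal_ofReal, ENNReal.top_mul hb.lintegral_ne_zero]
    exact ENNReal.ofReal_lt_top
  have hE : ∀ᶠ p : ℝ in 𝓝[>] 0, ENNReal.ofReal p < ∫⁻ x, ENNReal.ofReal (b x) ∂μ := by
    refine mem_nhdsWithin_of_mem_nhds (ENNReal.continuous_ofReal.continuousAt.eventually_lt
      continuousAt_const (by rw [ENNReal.ofReal_zero]; exact pos_iff_ne_zero.2 hb.lintegral_ne_zero))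
  obtain ⟨p, ⟨h, hp⟩, hE⟩ := (((eventually_lt_lintegral (fun p =>
    (Real.measurable_log.comp_aemeasurable
      ((hb.aemeasurable.div_const p).const_add 1)).ennreal_ofReal) hlim hc).and
    self_mem_nhdsWithin).and hE).exists
  have hp0 : 0 < p := hp
  refine ⟨p, ⟨hp0, hE⟩, lt_of_lt_of_le ?_
    (hb.le_optimalRate ⟨hp0, hE⟩ one_half_pos.le one_half_lt_one)⟩
  have hi := hb.integrable_log_one_add_div hp0
  simp only [Function.comp_def] at h
  rw [← ofReal_integral_eq_lintegral_ofReal hi, ENNReal.ofReal_lt_ofReal_iff_of_nonneg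
    (add_nonneg (le_max_right _ _) (Real.log_nonneg one_le_two))] at h
  · have h1 : ∫ x, Real.log (gain p (1 / 2) (b x)) ∂μ =
        ∫ x, (Real.log (1 + b x / p) - Real.log 2) ∂μ := by
      apply integral_congr_ae
      filter_upwards [hb.nonneg] with x hx
      have := div_nonneg hx hp0.le
      rw [← Real.log_div (by positivity) two_ne_zero]
      congr 1
      unfold gain
      ring
    rw [h1, integral_sub hi (integrable_const _), integral_const, probReal_univ, one_smul]
    linarith [le_max_left y 0]
  · filter_upwards [hb.nonneg] with x hx
    have := div_nonneg hx hp0.le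
    exact Real.log_nonneg (by linarith)

/-- The optimal growth rate tends to `0` as the price tends to the expectation. -/
lemma exists_optimalRate_lt (hb : IsProfit μ b) {y : ℝ} (hy : 0 < y) :
    ∃ p ∈ favourablePrices μ b, optimalRate μ b p < y := by
  by_cases hfin : ∫⁻ x, ENNReal.ofReal (b x) ∂μ = ⊤
  · have hlim : Tendsto (fun p => ∫ x, Real.log (1 + b x / p) ∂μ) atTop (𝓝 (∫ _, 0 ∂μ)) := by
      refine tendsto_integral_filter_of_dominated_convergence (fun x => Real.log (1 + b x))
        (Eventually.of_forall fun p => (Real.measurable_log.comp_aemeasurable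
          ((hb.aemeasurable.div_const p).const_add 1)).aestronglyMeasurable) ?_
        hb.integrable_log (ae_of_all _ fun x => ?_)
      · filter_upwards [eventually_ge_atTop 1] with p hp
        filter_upwards [hb.nonneg] with x hx
        have h1 : 0 ≤ b x / p := by positivity
        rw [Real.norm_of_nonneg (Real.log_nonneg (by linarith))]
        exact Real.log_le_log (by positivity) (by linarith [div_le_self hx hp])
      · have h1 : Tendsto (fun p : ℝ => 1 + b x / p) atTop (𝓝 (1 + 0)) :=
          (tendsto_const_nhds.div_atTop tendsto_id).const_add 1
        have h2 := h1.log (by norm_num)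
        simpa using h2
    rw [integral_zero] at hlim
    obtain ⟨p, h, hp⟩ := ((hlim.eventually (gt_mem_nhds hy)).and (eventually_gt_atTop 0)).exists
    have hpS : p ∈ favourablePrices μ b := ⟨hp, hfin ▸ ENNReal.ofReal_lt_top⟩
    have ho := hb.isOptimal_optimalShare hpS
    refine ⟨p, hpS, lt_of_le_of_lt ?_ h⟩
    refine integral_mono_ae (ho.integrable_log hb hp) (hb.integrable_log_one_add_div hp) ?_
    filter_upwards [ho.gain_pos, hb.nonneg] with x hx hx'
    exact Real.log_le_log hx (gain_le hp hx' ho.pos.le ho.le_one)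
  · have hi : Integrable b μ :=
      ⟨hb.aemeasurable.aestronglyMeasurable, (hasFiniteIntegral_iff_ofReal hb.nonneg).2
        (lt_top_iff_ne_top.2 hfin)⟩
    have hEq := ofReal_integral_eq_lintegral_ofReal hi hb.nonneg
    have hE : 0 < ∫ x, b x ∂μ := by
      by_contra! hle
      exact hb.lintegral_ne_zero (hEq ▸ ENNReal.ofReal_eq_zero.2 hle)
    -- This price makes the expected linear gain `E / p - 1` equal to `y / 2`.
    set p := (∫ x, b x ∂μ) / (1 + y / 2) with hpdef
    have hp : 0 < p := by positivity
    have hpE : p < ∫ x, b x ∂μ := div_lt_self hE (by linarith)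
    have hdiv : (∫ x, b x ∂μ) / p - 1 = y / 2 := by
      rw [hpdef]
      field_simp
      ring
    have hpS : p ∈ favourablePrices μ b := by
      refine ⟨hp, ?_⟩
      rw [← hEq]
      exact (ENNReal.ofReal_lt_ofReal_iff hE).2 hpE
    have ho := hb.isOptimal_optimalShare hpS
    refine ⟨p, hpS, ?_⟩
    have hlin : Integrable (fun x => optimalShare μ b p * (b x / p - 1)) μ :=
      ((hi.div_const p).sub (integrable_const 1)).const_mul _
    have h1 : optimalRate μ b p ≤ ∫ x, optimalShare μ b p * (b x / p - 1) ∂μ := by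
      refine integral_mono_ae (ho.integrable_log hb hp) hlin ?_
      filter_upwards [ho.gain_pos] with x hx
      refine (Real.log_le_sub_one_of_pos hx).trans_eq ?_
      unfold gain
      ring
    rw [integral_const_mul, integral_sub (hi.div_const p) (integrable_const 1), integral_div,
      integral_const, probReal_univ, one_smul, hdiv] at h1
    nlinarith [ho.le_one]

lemma image_optimalRate (hb : IsProfit μ b) :
    optimalRate μ b '' favourablePrices μ b = Ioi 0 := by
  apply Subset.antisymm
  · rintro _ ⟨p, hp, rfl⟩
    exact hb.optimalRate_pos hp
  · intro y hy
    obtain ⟨p, hp, h⟩ := hb.exists_lt_optimalRate y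
    obtain ⟨q, hq, h'⟩ := hb.exists_optimalRate_lt hy
    exact ordConnected_favourablePrices.isPreconnected.intermediate_value hq hp
      hb.continuousOn_optimalRate ⟨h'.le, h.le⟩

lemma image_optimalRate_Ioi (hb : IsProfit μ b) (hq : q ∈ favourablePrices μ b) :
    optimalRate μ b '' (favourablePrices μ b ∩ Ioi q) = Ioo 0 (optimalRate μ b q) := by
  apply Subset.antisymm
  · rintro _ ⟨p, hp, rfl⟩
    exact ⟨hb.optimalRate_pos hp.1, hb.strictAntiOn_optimalRate hq hp.1 hp.2⟩
  · intro y hy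
    obtain ⟨p, hp, rfl⟩ := hb.image_optimalRate.ge hy.1
    exact ⟨p, ⟨hp, (hb.strictAntiOn_optimalRate.lt_iff_gt hp hq).1 hy.2⟩, rfl⟩

end IsProfit

end Shares

section Games

/-! ### A game bounded below and its nonnegative shifts -/

variable {μ : Measure ℝ} {a : ℝ → ℝ} {c ξ u t : ℝ}

/-- Shifting the game by `c` turns proportions into shares: the proportion `t` at the price `u` of
the game `a` is the share `t * (u - c) / u` at the price `u - c` of the game `a - c`. -/
lemma gain_shift (hu : 0 < u) (hc : c < u) (x : ℝ) :
    gain (u - c) (t * (u - c) / u) (x - c) = x * t / u - t + 1 := by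
  have h1 := hu.ne'
  have h2 := (sub_pos.2 hc).ne'
  unfold gain
  field_simp
  ring

lemma w_eq (hu : 0 < u) (hc : c < u) :
    w μ a u t =
      (u - c) / u * meanSlope μ (fun x => a x - c) (u - c) (t * (u - c) / u) := by
  have h1 := hu.ne'
  have h2 := (sub_pos.2 hc).ne'
  unfold w meanSlope
  rw [← integral_const_mul]
  congr 1
  funext x
  unfold slope
  rw [gain_shift hu hc]
  have h3 : a x * t / u - t + 1 = (a x * t - u * t + u) / u := by
    field_simp
  have h4 : (a x - c) / (u - c) - 1 = (a x - u) / (u - c) := by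
    field_simp
    ring
  rw [h3, h4]
  field_simp

lemma isPreOptimal_iff (hu : 0 < u) (hξ : ξ < u) :
    IsPreOptimal μ a ξ u t ↔ t * (u - ξ) / u ∈ Ioo (0 : ℝ) 1 ∧
      meanSlope μ (fun x => a x - ξ) (u - ξ) (t * (u - ξ) / u) = 0 := by
  have hp := sub_pos.2 hξ
  unfold IsPreOptimal
  rw [w_eq hu hξ, mul_eq_zero, or_iff_right (div_pos hp hu).ne', mem_Ioo, mem_Ioo,
    div_lt_one hu, lt_div_iff₀ hp, div_pos_iff_of_pos_right hu, mul_pos_iff_of_pos_right hp]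

lemma invHarmonic_nonneg : 0 ≤ invHarmonic μ a c := ENNReal.toReal_nonneg

lemma tbar_of_nonneg (hξ : 0 ≤ ξ) (hu : 0 < u) (hE : (u : EReal) < expectation μ a) :
    tbar μ a ξ u = if u ≤ invHarmonic μ a 0 then 1 else preOptimal μ a ξ u := by
  unfold tbar
  rcases hξ.eq_or_lt with rfl | h
  · simp [hu.ne', hE]
  · simp [h, hE]

lemma tbar_of_neg (hξ : ξ < 0) (hu : 0 < u) (hE : (u : EReal) < expectation μ a) :
    tbar μ a ξ u =
      if u - ξ ≤ invHarmonic μ a ξ then u / (u - ξ) else preOptimal μ a ξ u := by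
  have h : u ≤ max 0 (ξ + invHarmonic μ a ξ) ↔ u - ξ ≤ invHarmonic μ a ξ := by
    rw [le_max_iff, or_iff_right hu.not_ge, sub_le_iff_le_add']
  unfold tbar
  simp [hξ.not_gt, hξ.ne, hE, h]

variable [IsProbabilityMeasure μ]

lemma isProfit_sub (ha : AEMeasurable a μ) (hc : ∀ᵐ x ∂μ, c ≤ a x)
    (hne : ∀ d : ℝ, ¬ ∀ᵐ x ∂μ, a x = d)
    (hG : IntegrableOn (fun x => Real.log (a x)) {x | 1 < a x} μ) :
    IsProfit μ (fun x => a x - c) where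
  aemeasurable := ha.sub_const c
  nonneg := by filter_upwards [hc] with x hx using sub_nonneg.2 hx
  not_ae_const d h := hne (d + c) (by filter_upwards [h] with x hx using by linarith)
  integrable_log := by
    have hi := hG.integrable_indicator₀ (nullMeasurableSet_lt aemeasurable_const ha)
    refine integrable_of_le_of_le (g₁ := 0) ?_ ?_ ?_ (integrable_zero _ _ _)
      ((integrable_const (Real.log (2 + |c|))).add hi)
    · exact (Real.measurable_log.comp_aemeasurable
        ((ha.sub_const c).const_add 1)).aestronglyMeasurable
    · filter_upwards [hc] with x hx
      exact Real.log_nonneg (by linarith)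
    · filter_upwards [hc] with x hx
      have h0 : 0 < 1 + (a x - c) := by linarith
      have h1 := neg_le_abs c
      have h2 := abs_nonneg c
      by_cases h : 1 < a x
      · rw [Pi.add_apply, indicator_of_mem (by exact h),
          ← Real.log_mul (by positivity) (by positivity)]
        exact Real.log_le_log h0 (by nlinarith)
      · rw [Pi.add_apply, indicator_of_notMem (by exact h), add_zero]
        exact Real.log_le_log h0 (by linarith)

/-- Being below the expectation is invariant under a shift that makes the game nonnegative, where the
expectation is a single Lebesgue integral. -/
lemma lt_expectation_iff (ha : AEMeasurable a μ) (hc : ∀ᵐ x ∂μ, c ≤ a x) (hu : c < u) :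
    (u : EReal) < expectation μ a ↔
      ENNReal.ofReal (u - c) < ∫⁻ x, ENNReal.ofReal (a x - c) ∂μ := by
  have hneg : ∫⁻ x, ENNReal.ofReal (-a x) ∂μ ≠ ⊤ := by
    have h : ∫⁻ x, ENNReal.ofReal (-a x) ∂μ ≤ ∫⁻ _, ENNReal.ofReal (-c) ∂μ := by
      refine lintegral_mono_ae ?_
      filter_upwards [hc] with x hx
      exact ENNReal.ofReal_le_ofReal (by linarith)
    rw [lintegral_const, measure_univ, mul_one] at h
    exact (h.trans_lt ENNReal.ofReal_lt_top).ne
  have hcoe : ∀ {y : ENNReal}, y ≠ ⊤ → (y : EReal) = ((y.toReal : ℝ) : EReal) := fun hy =>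
    (EReal.coe_ennreal_toReal hy).symm
  by_cases hpos : ∫⁻ x, ENNReal.ofReal (a x) ∂μ = ⊤
  · have h1 : ∫⁻ x, ENNReal.ofReal (a x - c) ∂μ = ⊤ := by
      have h2 : ∫⁻ x, ENNReal.ofReal (a x) ∂μ ≤
          ∫⁻ x, ENNReal.ofReal (a x - c) ∂μ + ENNReal.ofReal c := by
        have h3 : ENNReal.ofReal c = ∫⁻ _, ENNReal.ofReal c ∂μ := by simp
        rw [h3, ← lintegral_add_right _ measurable_const]
        refine lintegral_mono fun x => ?_
        exact (ENNReal.ofReal_le_ofReal (by linarith)).trans ENNReal.ofReal_add_le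
      by_contra h
      rw [hpos] at h2
      exact (ENNReal.add_lt_top.2 ⟨lt_top_iff_ne_top.2 h, ENNReal.ofReal_lt_top⟩).not_ge h2
    unfold expectation
    rw [hpos, h1, hcoe hneg, EReal.coe_ennreal_top, EReal.top_sub_coe]
    exact iff_of_true (EReal.coe_lt_top _) ENNReal.ofReal_lt_top
  · have hi : Integrable a μ := by
      refine ⟨ha.aestronglyMeasurable, ?_⟩
      rw [hasFiniteIntegral_iff_norm]
      have h1 : ∀ x, ENNReal.ofReal ‖a x‖ ≤ ENNReal.ofReal (a x) + ENNReal.ofReal (-a x) := by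
        intro x
        rcases le_total 0 (a x) with h | h
        · rw [Real.norm_of_nonneg h]
          exact le_self_add
        · rw [Real.norm_of_nonpos h]
          exact le_add_self
      refine (lintegral_mono h1).trans_lt ?_
      rw [lintegral_add_left' ha.ennreal_ofReal]
      exact ENNReal.add_lt_top.2 ⟨lt_top_iff_ne_top.2 hpos, lt_top_iff_ne_top.2 hneg⟩
    have h2 : expectation μ a = ((∫ x, a x ∂μ : ℝ) : EReal) := by
      unfold expectation
      rw [hcoe hpos, hcoe hneg, ← EReal.coe_sub,
        integral_eq_lintegral_pos_part_sub_lintegral_neg_part hi]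
    have hi' : Integrable (fun x => a x - c) μ := hi.sub (integrable_const c)
    rw [h2, EReal.coe_lt_coe_iff, ← ofReal_integral_eq_lintegral_ofReal hi'
        (by filter_upwards [hc] with x hx using sub_nonneg.2 hx),
      ENNReal.ofReal_lt_ofReal_iff_of_nonneg (sub_nonneg.2 hu.le),
      integral_sub hi (integrable_const c), integral_const, probReal_univ, one_smul,
      sub_lt_sub_iff_right]

lemma le_invHarmonic_iff (ha : AEMeasurable a μ) :
    u ≤ invHarmonic μ a c ↔
      ENNReal.ofReal u * ∫⁻ x, (ENNReal.ofReal (a x - c))⁻¹ ∂μ ≤ 1 := by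
  have hm : AEMeasurable (fun x => (ENNReal.ofReal (a x - c))⁻¹) μ :=
    (ha.sub_const c).ennreal_ofReal.inv
  have h0 : ∫⁻ x, (ENNReal.ofReal (a x - c))⁻¹ ∂μ ≠ 0 := by
    rw [Ne, lintegral_eq_zero_iff' hm]
    intro h
    obtain ⟨x, hx⟩ := h.exists
    simp at hx
  unfold invHarmonic harmonic
  rw [← ENNReal.ofReal_le_iff_le_toReal (ENNReal.inv_ne_top.2 h0),
    ENNReal.le_inv_iff_mul_le]

/-! ### The proportion as an optimal share of the shifted game -/

lemma IsPreOptimal.eq {t' : ℝ} (h : IsPreOptimal μ a ξ u t) (h' : IsPreOptimal μ a ξ u t')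
    (hb : IsProfit μ fun x => a x - ξ) (hu : 0 < u) (hξ : ξ < u) : t = t' := by
  have hp := sub_pos.2 hξ
  rw [isPreOptimal_iff hu hξ] at h h'
  have := (hb.isOptimal_of_meanSlope_eq_zero hp h.1 h.2).eq
    (hb.isOptimal_of_meanSlope_eq_zero hp h'.1 h'.2) hb hp
  rwa [div_left_inj' hu.ne', mul_left_inj' hp.ne'] at this

lemma exists_isPreOptimal (ha : AEMeasurable a μ) (hge : ∀ᵐ x ∂μ, ξ ≤ a x)
    (hb : IsProfit μ fun x => a x - ξ) (hu : 0 < u) (hξ : ξ < u)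
    (hH : ξ + invHarmonic μ a ξ < u) (hE : (u : EReal) < expectation μ a) :
    ∃ t, IsPreOptimal μ a ξ u t := by
  have hp := sub_pos.2 hξ
  obtain ⟨r, hr, h0⟩ := hb.exists_meanSlope_eq_zero hp ((lt_expectation_iff ha hge hξ).1 hE)
    (not_le.1 ((le_invHarmonic_iff ha).not.1 (by linarith)))
  refine ⟨r * u / (u - ξ), (isPreOptimal_iff hu hξ).2 ?_⟩
  have : r * u / (u - ξ) * (u - ξ) / u = r := by field_simp
  rw [this]
  exact ⟨hr, h0⟩

/-- The proportion `t̄_u` is the optimal share of the game shifted by `min ξ 0`. The shares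
`0 < r ≤ 1` of that game are the proportions `0 < t ≤ 1` for `ξ ≥ 0`, and `0 < t ≤ u / (u - ξ)` for
`ξ < 0`. -/
lemma isOptimal_tbar (ha : AEMeasurable a μ) (hge : ∀ᵐ x ∂μ, ξ ≤ a x)
    (hb : ∀ c ≤ ξ, IsProfit μ fun x => a x - c) (hu : 0 < u)
    (hE : (u : EReal) < expectation μ a) :
    IsOptimal μ (fun x => a x - min ξ 0) (u - min ξ 0)
      (tbar μ a ξ u * (u - min ξ 0) / u) := by
  rcases le_or_gt 0 ξ with hξ | hξ
  · have hge0 : ∀ᵐ x ∂μ, 0 ≤ a x := by filter_upwards [hge] with x hx using hξ.trans hx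
    have hu' : 0 < u - 0 := by linarith
    rw [tbar_of_nonneg hξ hu hE, min_eq_right hξ]
    split_ifs with h
    · have : 1 * (u - 0) / u = 1 := by
        rw [sub_zero, one_mul, div_self hu.ne']
      rw [this]
      refine (hb 0 hξ).isOptimal_one hu' ?_
      rw [sub_zero]
      exact (le_invHarmonic_iff ha).1 h
    · have hH := not_le.1 ((le_invHarmonic_iff ha).not.1 h)
      -- The harmonic mean of `a` is at least its lower bound `ξ`.
      have hξu : ξ < u := by
        by_contra! hle
        refine hH.not_ge ?_
        have h1 : ∫⁻ x, (ENNReal.ofReal (a x - 0))⁻¹ ∂μ ≤ ∫⁻ _, (ENNReal.ofReal u)⁻¹ ∂μ := by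
          refine lintegral_mono_ae ?_
          filter_upwards [hge] with x hx
          exact ENNReal.inv_le_inv.2 (ENNReal.ofReal_le_ofReal (by linarith))
        rw [lintegral_const, measure_univ, mul_one] at h1
        exact (mul_le_mul_right h1 _).trans (ENNReal.mul_inv_le_one _)
      obtain ⟨r, hr, h0⟩ := (hb 0 hξ).exists_meanSlope_eq_zero hu'
        ((lt_expectation_iff ha hge0 hu).1 hE) (by rwa [sub_zero u])
      have hru : r * (u - 0) / u = r := by
        rw [sub_zero, mul_div_assoc, div_self hu.ne', mul_one]
      -- For `ξ > 0` the interval `(0, u / (u - ξ))` is larger than `(0, 1)`, where the solution `r` was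
      -- found; by uniqueness on the larger interval `r` is the chosen solution.
      have hpre : IsPreOptimal μ a ξ u r := by
        refine ⟨⟨hr.1, hr.2.trans_le ?_⟩, ?_⟩
        · rw [le_div_iff₀ (sub_pos.2 hξu)]
          linarith
        · rw [w_eq hu hu, hru, h0, mul_zero]
      have : preOptimal μ a ξ u = r :=
        IsPreOptimal.eq (Classical.epsilon_spec ⟨r, hpre⟩) hpre (hb ξ le_rfl) hu hξu
      rw [this, hru]
      exact (hb 0 hξ).isOptimal_of_meanSlope_eq_zero hu' hr h0
  · have hξu : ξ < u := hξ.trans hu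
    have hp := sub_pos.2 hξu
    rw [tbar_of_neg hξ hu hE, min_eq_left hξ.le]
    split_ifs with h
    · have : u / (u - ξ) * (u - ξ) / u = 1 := by
        rw [div_mul_cancel₀ _ hp.ne', div_self hu.ne']
      rw [this]
      exact (hb ξ le_rfl).isOptimal_one hp ((le_invHarmonic_iff ha).1 h)
    · have hpre := (isPreOptimal_iff hu hξu).1 (Classical.epsilon_spec
        (exists_isPreOptimal ha hge (hb ξ le_rfl) hu hξu (by linarith) hE))
      exact (hb ξ le_rfl).isOptimal_of_meanSlope_eq_zero hp hpre.1 hpre.2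

/-! ### The growth rate -/

lemma mem_prices_iff (ha : AEMeasurable a μ) (hge : ∀ᵐ x ∂μ, ξ ≤ a x) :
    u ∈ prices μ a ↔
      u - min ξ 0 ∈ favourablePrices μ (fun x => a x - min ξ 0) ∩ Ioi (-min ξ 0) := by
  have h0 : min ξ 0 ≤ 0 := min_le_right _ _
  have hc : ∀ᵐ x ∂μ, min ξ 0 ≤ a x := by
    filter_upwards [hge] with x hx using (min_le_left _ _).trans hx
  have key : 0 < u → ((u : EReal) < expectation μ a ↔ ENNReal.ofReal (u - min ξ 0) <
      ∫⁻ x, ENNReal.ofReal (a x - min ξ 0) ∂μ) := fun hu =>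
    lt_expectation_iff ha hc (h0.trans_lt hu)
  simp only [prices, favourablePrices, mem_ofPred_eq, mem_inter_iff, mem_Ioi]
  constructor
  · rintro ⟨hu, h⟩
    exact ⟨⟨by linarith, (key hu).1 h⟩, by linarith⟩
  · rintro ⟨⟨_, h⟩, h'⟩
    have hu : 0 < u := by linarith
    exact ⟨hu, (key hu).2 h⟩

lemma image_prices (ha : AEMeasurable a μ) (hge : ∀ᵐ x ∂μ, ξ ≤ a x) :
    (fun u => u - min ξ 0) '' prices μ a =
      favourablePrices μ (fun x => a x - min ξ 0) ∩ Ioi (-min ξ 0) := by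
  ext p
  constructor
  · rintro ⟨u, hu, rfl⟩
    exact (mem_prices_iff ha hge).1 hu
  · intro hp
    refine ⟨p + min ξ 0, (mem_prices_iff ha hge).2 ?_, add_sub_cancel_right _ _⟩
    rwa [add_sub_cancel_right]

lemma growth_tbar (ha : AEMeasurable a μ) (hge : ∀ᵐ x ∂μ, ξ ≤ a x)
    (hb : ∀ c ≤ ξ, IsProfit μ fun x => a x - c) (hu : u ∈ prices μ a) :
    growth μ a u (tbar μ a ξ u) =
      Real.exp (optimalRate μ (fun x => a x - min ξ 0) (u - min ξ 0)) := by
  have hu' : min ξ 0 < u := (min_le_right _ _).trans_lt hu.1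
  unfold growth optimalRate
  rw [(hb _ (min_le_left _ _)).optimalShare_eq ((mem_prices_iff ha hge).1 hu).1
    (isOptimal_tbar ha hge hb hu.1 hu.2)]
  simp_rw [gain_shift hu.1 hu']

lemma tbar_div (ha : AEMeasurable a μ) (hge : ∀ᵐ x ∂μ, ξ ≤ a x)
    (hb : ∀ c ≤ ξ, IsProfit μ fun x => a x - c) (hu : u ∈ prices μ a) :
    tbar μ a ξ u / u =
      optimalShare μ (fun x => a x - min ξ 0) (u - min ξ 0) / (u - min ξ 0) := by
  have hu' : 0 < u - min ξ 0 := sub_pos.2 ((min_le_right _ _).trans_lt hu.1)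
  rw [(hb _ (min_le_left _ _)).optimalShare_eq ((mem_prices_iff ha hge).1 hu).1
    (isOptimal_tbar ha hge hb hu.1 hu.2)]
  field_simp

lemma image_exp_Ioi (x : ℝ) : Real.exp '' Ioi x = Ioi (Real.exp x) := by
  ext y
  constructor
  · rintro ⟨z, hz, rfl⟩
    exact Real.exp_lt_exp.2 hz
  · intro hy
    have hy0 : 0 < y := (Real.exp_pos x).trans hy
    exact ⟨Real.log y, (Real.lt_log_iff_exp_lt hy0).2 hy, Real.exp_log hy0⟩

lemma image_exp_Ioo (x y : ℝ) : Real.exp '' Ioo x y = Ioo (Real.exp x) (Real.exp y) := by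
  rw [← Ioi_inter_Iio, image_inter Real.exp_injective, image_exp_Ioi]
  ext z
  constructor
  · rintro ⟨hz, ⟨s, hs, rfl⟩⟩
    exact ⟨hz, Real.exp_lt_exp.2 hs⟩
  · rintro ⟨hz, hz'⟩
    have hz0 : 0 < z := (Real.exp_pos x).trans hz
    exact ⟨hz, Real.log z, (Real.log_lt_iff_lt_exp hz0).2 hz', Real.exp_log hz0⟩

end Games

end GrowthRate

theorem theorem4p1
    (I : Set ℝ) (hI : I.OrdConnected)
    (F : StieltjesFunction ℝ) (hF : F.measure I = 1)
    (a : ℝ → ℝ) (ha : AEMeasurable a (GrowthRate.law F I))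
    -- `ξ` is the infimum of `a` on `I`, and the essential infimum
    (ξ : ℝ) (hξ : IsGLB (a '' I) ξ)
    (hess : ∀ ε > 0, 0 < GrowthRate.law F I {x | a x < ξ + ε})
    -- `a` is not almost everywhere constant
    (hconst : ∃ δ > 0, GrowthRate.law F I {x | a x < ξ + δ} < 1)
    (hE : 0 < GrowthRate.expectation (GrowthRate.law F I) a)
    -- the growth rate is finite
    (hG : IntegrableOn (fun x => Real.log (a x)) {x | 1 < a x} (GrowthRate.law F I)) :
    -- the pre-optimal proportion is well defined
    (∀ u : ℝ, max 0 (ξ + GrowthRate.invHarmonic (GrowthRate.law F I) a ξ) < u →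
      (u : EReal) < GrowthRate.expectation (GrowthRate.law F I) a →
      ∃! t, GrowthRate.IsPreOptimal (GrowthRate.law F I) a ξ u t) ∧
    -- the integral that defines the growth rate at `t̄_u` converges
    (∀ u ∈ GrowthRate.prices (GrowthRate.law F I) a,
      Integrable
        (fun x => Real.log (a x * GrowthRate.tbar (GrowthRate.law F I) a ξ u / u
          - GrowthRate.tbar (GrowthRate.law F I) a ξ u + 1)) (GrowthRate.law F I)) ∧
    ContinuousOn
      (fun u => GrowthRate.growth (GrowthRate.law F I) a u
        (GrowthRate.tbar (GrowthRate.law F I) a ξ u))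
      (GrowthRate.prices (GrowthRate.law F I) a) ∧
    StrictAntiOn
      (fun u => GrowthRate.growth (GrowthRate.law F I) a u
        (GrowthRate.tbar (GrowthRate.law F I) a ξ u))
      (GrowthRate.prices (GrowthRate.law F I) a) ∧
    (0 ≤ ξ →
      (fun u => GrowthRate.growth (GrowthRate.law F I) a u
        (GrowthRate.tbar (GrowthRate.law F I) a ξ u)) ''
        (GrowthRate.prices (GrowthRate.law F I) a) = Ioi 1) ∧
    (ξ < 0 →
      ∃ η : ℝ, 0 < η ∧
        Tendsto (fun u => GrowthRate.tbar (GrowthRate.law F I) a ξ u / u) (𝓝[>] 0) (𝓝 η) ∧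
        Integrable (fun x => Real.log (a x * η + 1)) (GrowthRate.law F I) ∧
        (fun u => GrowthRate.growth (GrowthRate.law F I) a u
          (GrowthRate.tbar (GrowthRate.law F I) a ξ u)) ''
          (GrowthRate.prices (GrowthRate.law F I) a) =
            Ioo 1 (Real.exp (∫ x, Real.log (a x * η + 1) ∂(GrowthRate.law F I)))) := by
  have hIm : MeasurableSet I := hI.measurableSet
  have : IsProbabilityMeasure (GrowthRate.law F I) :=
    ⟨by rw [GrowthRate.law, Measure.restrict_apply_univ, hF]⟩
  have hge : ∀ᵐ x ∂GrowthRate.law F I, ξ ≤ a x :=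
    (ae_restrict_iff' hIm).2 (ae_of_all _ fun x hx => hξ.1 (mem_image_of_mem a hx))
  generalize GrowthRate.law F I = μ at *
  have hne : ∀ d : ℝ, ¬ ∀ᵐ x ∂μ, a x = d := by
    intro d hd
    obtain ⟨δ, hδ, hlt⟩ := hconst
    have hd' : ξ + δ ≤ d := by
      by_contra! h
      refine hlt.ne ((measure_congr (eventuallyEq_univ.2 ?_)).trans measure_univ)
      filter_upwards [hd] with x hx
      exact hx.trans_lt h
    refine (hess δ hδ).ne' (measure_mono_null ?_ (ae_iff.1 hd))
    intro x hx hx'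
    exact (hd'.trans_eq hx'.symm).not_gt hx
  have hb : ∀ c ≤ ξ, GrowthRate.IsProfit μ fun x => a x - c := fun c hc =>
    GrowthRate.isProfit_sub ha (by filter_upwards [hge] with x hx using hc.trans hx) hne hG
  have hbm := hb (min ξ 0) (min_le_left _ _)
  have hgrowth : EqOn (fun u => GrowthRate.growth μ a u (GrowthRate.tbar μ a ξ u))
      (fun u => Real.exp (GrowthRate.optimalRate μ (fun x => a x - min ξ 0) (u - min ξ 0)))
      (GrowthRate.prices μ a) := fun u hu => GrowthRate.growth_tbar ha hge hb hu
  have hmaps : MapsTo (fun u => u - min ξ 0) (GrowthRate.prices μ a)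
      (GrowthRate.favourablePrices μ fun x => a x - min ξ 0) := fun u hu =>
    ((GrowthRate.mem_prices_iff ha hge).1 hu).1
  have himage : (fun u => GrowthRate.growth μ a u (GrowthRate.tbar μ a ξ u)) ''
      GrowthRate.prices μ a = Real.exp '' (GrowthRate.optimalRate μ (fun x => a x - min ξ 0) ''
        (GrowthRate.favourablePrices μ (fun x => a x - min ξ 0) ∩ Ioi (-min ξ 0))) := by
    rw [hgrowth.image_eq, ← GrowthRate.image_prices ha hge, image_image, image_image]
  refine ⟨fun u hu hE => ?_, fun u hu => ?_, ?_, ?_, fun hξ0 => ?_, fun hξ0 => ?_⟩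
  · have hu0 : 0 < u := (le_max_left _ _).trans_lt hu
    have hH : ξ + GrowthRate.invHarmonic μ a ξ < u := (le_max_right _ _).trans_lt hu
    have hξu : ξ < u := (le_add_of_nonneg_right GrowthRate.invHarmonic_nonneg).trans_lt hH
    obtain ⟨t, ht⟩ := GrowthRate.exists_isPreOptimal ha hge (hb ξ le_rfl) hu0 hξu hH hE
    exact ⟨t, ht, fun t' ht' => ht'.eq ht (hb ξ le_rfl) hu0 hξu⟩
  · have h := (GrowthRate.isOptimal_tbar ha hge hb hu.1 hu.2).integrable_log hbm (hmaps hu).1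
    simpa only [GrowthRate.gain_shift hu.1 ((min_le_right ξ 0).trans_lt hu.1)] using h
  · refine ContinuousOn.congr ?_ hgrowth
    exact Real.continuous_exp.comp_continuousOn
      (hbm.continuousOn_optimalRate.comp (by fun_prop) hmaps)
  · intro u hu v hv huv
    rw [hgrowth hu, hgrowth hv]
    exact Real.exp_lt_exp.2
      (hbm.strictAntiOn_optimalRate (hmaps hu) (hmaps hv) (sub_lt_sub_right huv _))
  · have hS : GrowthRate.favourablePrices μ (fun x => a x - min ξ 0) ∩ Ioi (-min ξ 0) =
        GrowthRate.favourablePrices μ (fun x => a x - min ξ 0) := by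
      refine inter_eq_left.2 fun p hp => ?_
      rw [min_eq_right hξ0, neg_zero]
      exact hp.1
    rw [himage, hS, hbm.image_optimalRate, GrowthRate.image_exp_Ioi, Real.exp_zero]
  · rw [min_eq_left hξ0.le] at himage hbm
    have hq : -ξ ∈ GrowthRate.favourablePrices μ fun x => a x - ξ := by
      refine ⟨neg_pos.2 hξ0, ?_⟩
      have h := (GrowthRate.lt_expectation_iff (u := 0) ha hge hξ0).1 (by simpa using hE)
      rwa [zero_sub] at h
    have ho := hbm.isOptimal_optimalShare hq
    -- At `u = 0` the shifted price is `-ξ`, and the gain is `1 + η a` for `η` the share per unit price.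
    have hgain : ∀ x, a x * (GrowthRate.optimalShare μ (fun x => a x - ξ) (-ξ) / -ξ) + 1 =
        GrowthRate.gain (-ξ) (GrowthRate.optimalShare μ (fun x => a x - ξ) (-ξ)) (a x - ξ) := by
      intro x
      have := hξ0.ne
      unfold GrowthRate.gain
      field_simp
      ring
    refine ⟨GrowthRate.optimalShare μ (fun x => a x - ξ) (-ξ) / -ξ, div_pos ho.pos hq.1, ?_, ?_, ?_⟩
    · have hcont : ContinuousAt
          (fun p => GrowthRate.optimalShare μ (fun x => a x - ξ) p / p) (0 - ξ) := by
        rw [zero_sub]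
        exact (hbm.continuousAt_optimalShare hq).div continuousAt_id hq.1.ne'
      have hshift : ContinuousAt (fun u : ℝ => u - ξ) 0 := by fun_prop
      have hlim := (hcont.comp (f := fun u : ℝ => u - ξ) hshift).tendsto
      simp only [Function.comp_def, zero_sub] at hlim
      refine (hlim.mono_left nhdsWithin_le_nhds).congr' ?_
      have hnear : ∀ᶠ u in 𝓝 (0 : ℝ), u - ξ ∈ GrowthRate.favourablePrices μ fun x => a x - ξ :=
        hshift.eventually_mem (by
          rw [zero_sub]
          exact GrowthRate.isOpen_favourablePrices.mem_nhds hq)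
      filter_upwards [nhdsWithin_le_nhds hnear, self_mem_nhdsWithin] with u hu hu0
      simp only [mem_Ioi] at hu0
      have hmem : u ∈ GrowthRate.prices μ a := by
        rw [GrowthRate.mem_prices_iff ha hge, min_eq_left hξ0.le]
        exact ⟨hu, by simp only [mem_Ioi]; linarith⟩
      rw [GrowthRate.tbar_div ha hge hb hmem, min_eq_left hξ0.le]
    · simp_rw [hgain]
      exact ho.integrable_log hbm hq.1
    · simp_rw [hgain]
      rw [himage, hbm.image_optimalRate_Ioi hq, GrowthRate.image_exp_Ioo, Real.exp_zero]
      rfl
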